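/- Let $l = 2\beta + 1 \geq 19$ be a prime, and let $N = p^{\alpha} q_1^{2\beta} \cdots q_r^{2\beta}$ be an odd perfect number (that is, $N$ is odd and the sum of its positive divisors is $2N$), where $p, q_1, \ldots, q_r$ are distinct primes and $\alpha$ is a nonnegative integer. Let $j \in \{1, \ldots, r\}$ be an index with $q_j \equiv 1 \pmod{l}$. Then the number of primes $q_i$ ($1 \leq i \leq r$) such that $q_i \not\equiv 1 \pmod{l}$ and $$\frac{q_i^l - 1}{q_i - 1} = p^m q_j \quad \text{for some integer } m \geq 0 \text{ (which may depend on } i)$$ is at most five if $l \geq 59$, and at most six if $19 \leq l \leq 53$. -/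

import Mathlib

/-!
The bound comes from the equation alone: for a prime `l ≥ 19` and primes `p`, `q` with
`q ≡ 1 [MOD l]`, at most four primes `x ≢ 1 [MOD l]` satisfy `1 + x + ⋯ + x ^ (l - 1) = p ^ m * q`
for some `m` (`card_prime_solutions_le_four`).

*Gaps.* Every solution is an `l`-th root of unity modulo `q` and modulo `p ^ m`, and there are at
most `l` of these. Hence, if `x` and `y` are two solutions, the monomials `x ^ a * y ^ b` below such
a modulus number at most `l` (`exists_le_pow_mul_pow`). Modulo `q` this bounds `q` by a power of the
second solution (`prime_le_pow`); modulo `p ^ m`, which is then close to `x ^ (l - 1)`, it makes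
the next solution a large power of `x` (`pow_le_of_lt`). So for solutions `x₁ < x₂ < ⋯` one has
`q ≤ x₃`, and `x₅ ≥ x₃ ^ (4 * l)`.

*No two large solutions.* Let `x < y` be solutions with exponents `m < M` and with `q ≤ x`. Some
root of unity `ω` modulo `p ^ M`, a power of `y`, is congruent to `x` modulo `p ^ m`, and `y = ω ^ k`
with `0 < k < l`. Thus `u = x / ω` is close to `1` in the `p`-adic sense and
`x ^ k / y = (x ^ l) ^ (k / l)` for the branch of the root near `1`. The `[n/n]` Padé approximants
to `(1 + z) ^ (k / l)` give integer polynomials `A`, `B` for which `u ^ k * A(u ^ l) - B(u ^ l)`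
vanishes to order `2 * n + 1` at `u = 1` (`sub_one_pow_dvd_pade`), so that
`x ^ k * A(x ^ l) - y * B(x ^ l)` is divisible by `p ^ min (m * (2 * n + 1)) M`
(`pow_dvd_pade_form`). For `n` about `log y / ((l - 7) * log x)` this integer is nonzero and too
small to be so divisible, once `y ≥ x ^ (4 * l)` (`lt_pow_of_geom_sum_eq`).
-/

/-! ### Padé approximants to `(1 + z) ^ (k / l)` with integer coefficients -/

open Finset in
/-- The integer `l ^ (2 * j) * (a + j - 1 choose j)` with `a = c / l`: a binomial coefficient with
rational argument of denominator `l`, cleared of denominators (see `factorial_dvd_pow_mul_prod`). -/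
def clearedChoose (l c j : ℕ) : ℕ := l ^ j * (∏ s ∈ range j, (c + l * s)) / j.factorial

open Finset in
/-- `l ^ j` absorbs the `l`-part of `j!`; modulo the prime-to-`l` part, `l` is invertible and the
product is that of `j` consecutive integers. -/
lemma factorial_dvd_pow_mul_prod {l : ℕ} (hl : l.Prime) (c j : ℕ) :
    j.factorial ∣ l ^ j * ∏ s ∈ range j, (c + l * s) := by
  obtain ⟨v, w, hw, hvw⟩ := Nat.exists_eq_pow_mul_and_not_dvd (Nat.factorial_ne_zero j) l hl.ne_one
  have hcop : Nat.Coprime l w := (Nat.Prime.coprime_iff_not_dvd hl).2 hw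
  have hv : v ≤ j := by
    have := Fact.mk hl
    have h1 : v ≤ padicValNat l j.factorial :=
      (padicValNat_dvd_iff_le (Nat.factorial_ne_zero j)).1 ⟨w, hvw⟩
    have h2 := sub_one_mul_padicValNat_factorial (p := l) j
    have h3 : 1 ≤ l - 1 := by have := hl.two_le; omega
    have h4 := Nat.mul_le_mul_right (padicValNat l j.factorial) h3
    omega
  have hw0 : 0 < w := by
    rcases Nat.eq_zero_or_pos w with h | h
    · subst h; simp at hw
    · exact h
  rw [hvw]
  refine mul_dvd_mul (pow_dvd_pow l hv) ?_
  set b := l ^ (w.totient - 1) with hb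
  have hlb : l * b ≡ 1 [MOD w] := by
    have h1 : l * b = l ^ w.totient := by
      rw [hb, ← pow_succ', Nat.sub_add_cancel (Nat.totient_pos.2 hw0)]
    rw [h1]; exact Nat.ModEq.pow_totient hcop
  have hprod : ∏ s ∈ range j, (c + l * s) ≡ l ^ j * ∏ s ∈ range j, (c * b + s) [MOD w] := by
    have h1 : l ^ j * ∏ s ∈ range j, (c * b + s) = ∏ s ∈ range j, (c * (l * b) + l * s) := by
      have h2 := pow_card_mul_prod (s := range j) (b := l) (f := fun s => c * b + s)
      rw [card_range] at h2
      rw [h2]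
      exact prod_congr rfl fun s _ => by ring
    rw [h1]
    refine Nat.ModEq.prod fun s _ => ?_
    simpa using ((hlb.symm.mul_left c).add_right (l * s))
  refine (hprod.dvd_iff dvd_rfl).2 (Dvd.dvd.mul_left ?_ _)
  rw [← Nat.ascFactorial_eq_prod_range]
  exact (Dvd.intro_left _ hvw.symm).trans (Nat.factorial_dvd_ascFactorial _ _)

open Finset in
lemma clearedChoose_mul_factorial {l : ℕ} (hl : l.Prime) (c j : ℕ) :
    clearedChoose l c j * j.factorial = l ^ j * ∏ s ∈ range j, (c + l * s) :=
  Nat.div_mul_cancel (factorial_dvd_pow_mul_prod hl c j)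

lemma clearedChoose_le {l c d : ℕ} (hl : l.Prime) (j : ℕ) (hc : c ≤ l * (d + 1)) :
    clearedChoose l c j ≤ l ^ (2 * j) * (d + j).choose j := by
  refine Nat.le_of_mul_le_mul_right ?_ (Nat.factorial_pos j)
  rw [clearedChoose_mul_factorial hl, mul_assoc, mul_comm (Nat.choose _ _),
    ← Nat.ascFactorial_eq_factorial_mul_choose, Nat.ascFactorial_eq_prod_range, two_mul, pow_add,
    mul_assoc]
  refine Nat.mul_le_mul_left _ ?_
  calc ∏ s ∈ Finset.range j, (c + l * s) ≤ ∏ s ∈ Finset.range j, l * (d + 1 + s) :=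
        Finset.prod_le_prod' fun s _ => by nlinarith
    _ = l ^ j * ∏ s ∈ Finset.range j, (d + 1 + s) := by
        rw [Finset.prod_mul_distrib, Finset.prod_const, Finset.card_range]

lemma le_clearedChoose {l c : ℕ} (hl : l.Prime) (j : ℕ) (hc : l ≤ c) :
    l ^ (2 * j) ≤ clearedChoose l c j := by
  refine Nat.le_of_mul_le_mul_right ?_ (Nat.factorial_pos j)
  rw [clearedChoose_mul_factorial hl, two_mul, pow_add, mul_assoc]
  refine Nat.mul_le_mul_left _ ?_
  calc l ^ j * j.factorial = ∏ s ∈ Finset.range j, l * (s + 1) := by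
        rw [Finset.prod_mul_distrib, Finset.prod_const, Finset.card_range,
          Finset.prod_range_add_one_eq_factorial]
    _ ≤ _ := Finset.prod_le_prod' fun s _ => by nlinarith

/-- Coefficients, cleared of denominators and without sign, of the `[n/n]` Padé approximants of
`(1 + z) ^ (k / l)` in powers of `1 + z`: numerator and denominator carry the same coefficients in
opposite order. -/
def padeCoeff (l k n i : ℕ) : ℕ :=
  clearedChoose l (l * (i + 1) - k) (n - i) * clearedChoose l (l * (n - i + 1) + k) i

lemma padeCoeff_le {l k n i : ℕ} (hl : l.Prime) (hk : k ≤ l) (hi : i ≤ n) :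
    padeCoeff l k n i ≤ l ^ (2 * n) * 2 ^ (n + 1) * n.choose i := by
  have h1 : clearedChoose l (l * (i + 1) - k) (n - i) ≤ l ^ (2 * (n - i)) * n.choose i := by
    have := clearedChoose_le (d := i) hl (n - i) (Nat.sub_le (l * (i + 1)) k)
    rwa [Nat.add_sub_cancel' hi, Nat.choose_symm hi] at this
  have h2 : clearedChoose l (l * (n - i + 1) + k) i ≤ l ^ (2 * i) * 2 ^ (n + 1) := by
    refine (clearedChoose_le (d := n - i + 1) hl i (by nlinarith)).trans ?_
    refine Nat.mul_le_mul_left _ ?_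
    have : n - i + 1 + i = n + 1 := by omega
    rw [this]
    exact Nat.choose_le_two_pow _ _
  calc padeCoeff l k n i
      ≤ (l ^ (2 * (n - i)) * n.choose i) * (l ^ (2 * i) * 2 ^ (n + 1)) := Nat.mul_le_mul h1 h2
    _ = l ^ (2 * (n - i) + 2 * i) * 2 ^ (n + 1) * n.choose i := by ring
    _ = _ := by congr 3; omega

lemma le_padeCoeff_self {l k : ℕ} (hl : l.Prime) (n : ℕ) : l ^ (2 * n) ≤ padeCoeff l k n n := by
  have := le_clearedChoose (c := l * (n - n + 1) + k) hl n (by rw [Nat.sub_self]; omega)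
  simpa [padeCoeff, clearedChoose] using this

/-- Applied to `padeCoeff` in either order, this bounds both polynomials of the approximation. -/
lemma sum_mul_pow_le {l n T : ℕ} (hT : 1 ≤ T) (b : ℕ → ℕ)
    (hb : ∀ i ≤ n, b i ≤ l ^ (2 * n) * 2 ^ (n + 1) * n.choose i) :
    ∑ i ∈ Finset.range (n + 1), b i * T ^ i ≤ 2 * (4 * l ^ 2 * T) ^ n := by
  calc ∑ i ∈ Finset.range (n + 1), b i * T ^ i
      ≤ ∑ i ∈ Finset.range (n + 1), l ^ (2 * n) * 2 ^ (n + 1) * (T ^ i * n.choose i) := by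
        refine Finset.sum_le_sum fun i hi => ?_
        have := hb i (Nat.lt_succ_iff.1 (Finset.mem_range.1 hi))
        nlinarith [Nat.mul_le_mul_right (T ^ i) this]
    _ = l ^ (2 * n) * 2 ^ (n + 1) * (T + 1) ^ n := by
        rw [← Finset.mul_sum, add_pow]; simp
    _ ≤ l ^ (2 * n) * 2 ^ (n + 1) * (2 * T) ^ n := by
        gcongr; omega
    _ = 2 * (4 * l ^ 2 * T) ^ n := by
        rw [mul_pow, mul_pow, mul_pow, ← pow_mul, show (4:ℕ) = 2 ^ 2 from rfl, ← pow_mul]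
        ring

open Finset in
/-- The coefficients are, up to a common factor, the inverses of the products of differences of
the nodes `l * i` and `l * i + k`, as Lagrange interpolation demands. -/
lemma padeCoeff_mul_prod_sub {l k n i : ℕ} (hl : l.Prime) (hk : k < l) (hi : i ≤ n) :
    (padeCoeff l k n i : ℚ) * ((∏ j ∈ (range (n + 1)).erase i, ((l * i : ℚ) - l * j)) *
      ∏ j ∈ range (n + 1), ((l * i : ℚ) - (l * j + k))) =
    -((l : ℚ) ^ (2 * n) * (∏ s ∈ range n, ((l * (s + 1) : ℚ) - k)) *
      ∏ s ∈ range (n + 1), ((l * s : ℚ) + k)) := by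
  obtain ⟨d, rfl⟩ := Nat.exists_eq_add_of_le hi
  have hsub : ((l * (i + 1) - k : ℕ) : ℚ) = l * (i + 1) - k := by
    rw [Nat.cast_sub (by nlinarith)]; push_cast; ring
  have h1 : (clearedChoose l (l * (i + 1) - k) d : ℚ) * d.factorial =
      l ^ d * ∏ s ∈ range d, ((l * (i + 1) : ℚ) - k + l * s) := by
    have := congrArg (Nat.cast : ℕ → ℚ) (clearedChoose_mul_factorial hl (l * (i + 1) - k) d)
    simpa [hsub] using this
  have h2 : (clearedChoose l (l * (d + 1) + k) i : ℚ) * i.factorial =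
      l ^ i * ∏ s ∈ range i, ((l * (d + 1) : ℚ) + k + l * s) := by
    have := congrArg (Nat.cast : ℕ → ℚ) (clearedChoose_mul_factorial hl (l * (d + 1) + k) i)
    simpa using this
  have h3 : ∏ j ∈ (range (i + d + 1)).erase i, ((l * i : ℚ) - l * j) =
      (-1) ^ d * l ^ (i + d) * i.factorial * d.factorial := by
    have : (range (i + d + 1)).erase i = range i ∪ (range d).map (addLeftEmbedding (i + 1)) := by
      ext j
      simp only [mem_erase, mem_range, mem_union, mem_map, addLeftEmbedding_apply]
      constructor
      · intro ⟨ha, hb⟩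
        rcases lt_or_gt_of_ne ha with h | h
        · exact Or.inl h
        · exact Or.inr ⟨j - (i + 1), by omega, by omega⟩
      · rintro (h | ⟨a, ha, rfl⟩) <;> omega
    rw [this, prod_union, prod_map]
    · have e1 : ∏ j ∈ range i, ((l * i : ℚ) - l * j) = l ^ i * i.factorial := by
        rw [← prod_range_reflect, ← prod_range_add_one_eq_factorial]
        push_cast
        rw [← card_range i, ← prod_const, card_range, ← prod_mul_distrib]
        refine prod_congr rfl fun j hj => ?_
        have hj := mem_range.1 hj
        rw [Nat.sub_sub, Nat.cast_sub (by omega)]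
        push_cast; ring
      have e2 : ∏ j ∈ range d, ((l * i : ℚ) - l * (addLeftEmbedding (i + 1) j : ℕ)) =
          (-1) ^ d * l ^ d * d.factorial := by
        rw [← prod_range_add_one_eq_factorial]
        push_cast
        rw [← mul_pow, ← card_range d, ← prod_const, card_range, ← prod_mul_distrib]
        refine prod_congr rfl fun j hj => ?_
        simp only [addLeftEmbedding_apply]
        push_cast; ring
      rw [e1, e2]; ring
    · rw [disjoint_left]
      intro a ha hb
      simp only [mem_range, mem_map, addLeftEmbedding_apply] at ha hb
      omega
  have h4 : ∏ j ∈ range (i + d + 1), ((l * i : ℚ) - (l * j + k)) =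
      (∏ s ∈ range i, ((l * (s + 1) : ℚ) - k)) *
        ((-1) ^ (d + 1) * ∏ s ∈ range (d + 1), ((l * s : ℚ) + k)) := by
    rw [add_assoc, prod_range_add]
    congr 1
    · rw [← prod_range_reflect]
      refine prod_congr rfl fun j hj => ?_
      have hj := mem_range.1 hj
      rw [Nat.sub_sub, Nat.cast_sub (by omega)]
      push_cast; ring
    · rw [← card_range (d + 1), ← prod_const, card_range, ← prod_mul_distrib]
      refine prod_congr rfl fun j hj => ?_
      push_cast; ring
  have h5 : ∏ s ∈ range (i + d), ((l * (s + 1) : ℚ) - k) =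
      (∏ s ∈ range i, ((l * (s + 1) : ℚ) - k)) *
        ∏ s ∈ range d, ((l * (i + 1) : ℚ) - k + l * s) := by
    rw [prod_range_add]
    congr 1
    refine prod_congr rfl fun j hj => ?_
    push_cast; ring
  have h6 : ∏ s ∈ range (i + d + 1), ((l * s : ℚ) + k) =
      (∏ s ∈ range (d + 1), ((l * s : ℚ) + k)) *
        ∏ s ∈ range i, ((l * (d + 1) : ℚ) + k + l * s) := by
    rw [show i + d + 1 = (d + 1) + i by ring, prod_range_add]
    congr 1
    refine prod_congr rfl fun j hj => ?_
    push_cast; ring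
  have hsign : (-1 : ℚ) ^ d * (-1) ^ (d + 1) = -1 := by
    rw [← pow_add]
    exact Odd.neg_one_pow ⟨d, by ring⟩
  rw [padeCoeff, h3, h4, h5, h6, Nat.add_sub_cancel_left]
  push_cast
  linear_combination
    ((l : ℚ) ^ (i + d) * (∏ s ∈ range i, ((l * (s + 1) : ℚ) - k)) *
      ∏ s ∈ range (d + 1), ((l * s : ℚ) + k)) *
    ((-1 : ℚ) ^ d * (-1) ^ (d + 1) * (clearedChoose l (l * (d + 1) + k) i * i.factorial) * h1
     + (-1 : ℚ) ^ d * (-1) ^ (d + 1) *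
      (l ^ d * ∏ s ∈ range d, ((l * (i + 1) : ℚ) - k + l * s)) * h2
     + (l ^ d * ∏ s ∈ range d, ((l * (i + 1) : ℚ) - k + l * s)) *
      (l ^ i * ∏ s ∈ range i, ((l * (d + 1) : ℚ) + k + l * s)) * hsign)

open Finset Polynomial in
lemma sum_padeCoeff_mul_eval {l k n : ℕ} (hl : l.Prime) (hk0 : 0 < k) (hk : k < l)
    {g : ℚ[X]} (hg : g.natDegree ≤ 2 * n) :
    ∑ i ∈ range (n + 1), (padeCoeff l k n (n - i) : ℚ) * g.eval ((l * i + k : ℕ) : ℚ) -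
      ∑ i ∈ range (n + 1), (padeCoeff l k n i : ℚ) * g.eval ((l * i : ℕ) : ℚ) = 0 := by
  set K : ℚ := (l : ℚ) ^ (2 * n) * (∏ s ∈ range n, ((l * (s + 1) : ℚ) - k)) *
      ∏ s ∈ range (n + 1), ((l * s : ℚ) + k) with hK
  have hl0 : (0 : ℚ) < l := by exact_mod_cast hl.pos
  have hkQ : (0 : ℚ) < k := by exact_mod_cast hk0
  have hklQ : (k : ℚ) < l := by exact_mod_cast hk
  have hK0 : K ≠ 0 := by
    have h1 : 0 < ∏ s ∈ range n, ((l * (s + 1) : ℚ) - k) := prod_pos fun s _ => by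
      have : (0 : ℚ) ≤ s := Nat.cast_nonneg s
      nlinarith
    have h2 : 0 < ∏ s ∈ range (n + 1), ((l * s : ℚ) + k) := prod_pos fun s _ => by
      positivity
    positivity
  set S : Finset (ℕ ⊕ ℕ) := (range (n + 1)).disjSum (range (n + 1)) with hS
  set v : ℕ ⊕ ℕ → ℚ := Sum.elim (fun i => (l * i : ℚ)) (fun i => (l * i + k : ℚ)) with hv
  clear_value K
  have hinj : Set.InjOn v S := by
    have hne : ∀ a b : ℕ, l * a ≠ l * b + k := by
      intro a b h
      have h1 : l ∣ k := (Nat.dvd_add_right (dvd_mul_right l b)).1 (h ▸ dvd_mul_right l a)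
      exact absurd (Nat.le_of_dvd hk0 h1) (by omega)
    rintro (a | a) _ (b | b) _ hab <;> simp only [hv, Sum.elim_inl, Sum.elim_inr] at hab
    · have : (a : ℚ) = b := mul_left_cancel₀ hl0.ne' hab
      rw [Nat.cast_injective this]
    · exact absurd (by exact_mod_cast hab) (hne a b)
    · exact absurd (by exact_mod_cast hab.symm) (hne b a)
    · have : (a : ℚ) = b := mul_left_cancel₀ hl0.ne' (by linarith)
      rw [Nat.cast_injective this]
  have hcard : #S = 2 * n + 2 := by rw [hS, card_disjSum, card_range]; ring
  have hdeg : g.degree < #S := by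
    rw [hcard]
    refine lt_of_le_of_lt (natDegree_le_iff_degree_le.1 hg) ?_
    exact_mod_cast (by omega : 2 * n < 2 * n + 2)
  have hlag := Lagrange.coeff_eq_sum hinj hdeg
  rw [hcard, coeff_eq_zero_of_natDegree_lt (by omega), hS, sum_disjSum] at hlag
  have hleft : ∀ i ∈ range (n + 1), g.eval (v (Sum.inl i)) / ∏ j ∈ S.erase (Sum.inl i),
      (v (Sum.inl i) - v j) = -K⁻¹ * ((padeCoeff l k n i : ℚ) * g.eval ((l * i : ℕ) : ℚ)) := by
    intro i hi
    have he : S.erase (Sum.inl i) = ((range (n + 1)).erase i).disjSum (range (n + 1)) := by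
      ext (a | a) <;> simp [hS]
    have := padeCoeff_mul_prod_sub hl hk (Nat.lt_succ_iff.1 (mem_range.1 hi))
    rw [← hK] at this
    rw [he, prod_disjSum]
    simp only [hv, Sum.elim_inl, Sum.elim_inr]
    set A := ∏ j ∈ (range (n + 1)).erase i, ((l * i : ℚ) - l * j)
    set B := ∏ j ∈ range (n + 1), ((l * i : ℚ) - (l * j + k))
    have hP : A * B ≠ 0 := by
      intro h0; rw [h0, mul_zero] at this; exact hK0 (by linarith)
    rw [div_eq_iff hP]
    push_cast
    field_simp
    linear_combination eval (l * i : ℚ) g * this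
  have hright : ∀ i ∈ range (n + 1), g.eval (v (Sum.inr i)) / ∏ j ∈ S.erase (Sum.inr i),
      (v (Sum.inr i) - v j) =
      K⁻¹ * ((padeCoeff l k n (n - i) : ℚ) * g.eval ((l * i + k : ℕ) : ℚ)) := by
    intro i hi
    have hin : i ≤ n := Nat.lt_succ_iff.1 (mem_range.1 hi)
    have he : S.erase (Sum.inr i) = (range (n + 1)).disjSum ((range (n + 1)).erase i) := by
      ext (a | a) <;> simp [hS]
    have := padeCoeff_mul_prod_sub hl hk (Nat.sub_le n i)
    rw [← hK] at this
    -- The reflection `j ↦ n - j` carries the differences at `l * (n - i)` to those at `l * i + k`.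
    have r1 : ∏ j ∈ (range (n + 1)).erase (n - i), ((l * (n - i : ℕ) : ℚ) - l * j) =
        (-1) ^ n * ∏ j ∈ (range (n + 1)).erase i, ((l * i + k : ℚ) - (l * j + k)) := by
      have hc : #((range (n + 1)).erase i) = n := by
        rw [card_erase_of_mem hi, card_range]; rfl
      have hc' := pow_card_mul_prod (s := (range (n + 1)).erase i) (b := (-1 : ℚ))
        (f := fun j => (l * i + k : ℚ) - (l * j + k))
      rw [hc] at hc'
      rw [hc']
      refine prod_nbij' (fun j => n - j) (fun j => n - j) ?_ ?_ ?_ ?_ ?_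
      · intro j hj; simp only [mem_erase, mem_range] at hj ⊢; omega
      · intro j hj; simp only [mem_erase, mem_range] at hj ⊢; omega
      · intro j hj; simp only [mem_erase, mem_range] at hj; omega
      · intro j hj; simp only [mem_erase, mem_range] at hj; omega
      · intro j hj
        simp only [mem_erase, mem_range] at hj
        rw [Nat.cast_sub hin, Nat.cast_sub (by omega)]; ring
    have r2 : ∏ j ∈ range (n + 1), ((l * (n - i : ℕ) : ℚ) - (l * j + k)) =
        (-1) ^ (n + 1) * ∏ j ∈ range (n + 1), ((l * i + k : ℚ) - l * j) := by
      conv_rhs => rw [← card_range (n + 1), ← prod_const, card_range, ← prod_mul_distrib]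
      rw [← prod_range_reflect]
      refine prod_congr rfl fun j hj => ?_
      have := mem_range.1 hj
      rw [Nat.cast_sub hin, Nat.add_sub_cancel, Nat.cast_sub (by omega)]; ring
    have hsign : (-1 : ℚ) ^ n * (-1) ^ (n + 1) = -1 := by
      rw [← pow_add]; exact Odd.neg_one_pow ⟨n, by ring⟩
    rw [r1, r2] at this
    rw [he, prod_disjSum]
    simp only [hv, Sum.elim_inl, Sum.elim_inr]
    set A := ∏ j ∈ (range (n + 1)).erase i, ((l * i + k : ℚ) - (l * j + k))
    set B := ∏ j ∈ range (n + 1), ((l * i + k : ℚ) - l * j)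
    have h2 : (padeCoeff l k n (n - i) : ℚ) * (B * A) = K := by
      linear_combination (-1 : ℚ) * this + (padeCoeff l k n (n - i) : ℚ) * A * B * hsign
    have hP : B * A ≠ 0 := by
      intro h0; rw [h0, mul_zero] at h2; exact hK0 h2.symm
    rw [div_eq_iff hP]
    push_cast
    field_simp
    linear_combination (-eval (l * i + k : ℚ) g) * h2
  rw [sum_congr rfl hleft, sum_congr rfl hright, ← mul_sum, ← mul_sum] at hlag
  field_simp at hlag
  linarith

open Finset Polynomial in
/-- The form `u ^ k * A(u ^ l) - B(u ^ l)` attached to the Padé approximants vanishes to order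
`2 * n + 1` at `u = 1`: its Taylor coefficients there are `∑ ± c_e * (e choose d)`, and `e choose d`
is a polynomial of degree `d` in the exponent `e`. -/
lemma sub_one_pow_dvd_pade {l k : ℕ} (hl : l.Prime) (hk0 : 0 < k) (hk : k < l) (n : ℕ) (u : ℤ) :
    (u - 1) ^ (2 * n + 1) ∣
      ∑ i ∈ range (n + 1), (padeCoeff l k n (n - i) : ℤ) * u ^ (l * i + k) -
        ∑ i ∈ range (n + 1), (padeCoeff l k n i : ℤ) * u ^ (l * i) := by
  set F : ℤ[X] := ∑ i ∈ range (n + 1), C (padeCoeff l k n (n - i) : ℤ) * X ^ (l * i + k) -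
        ∑ i ∈ range (n + 1), C (padeCoeff l k n i : ℤ) * X ^ (l * i) with hF
  suffices h : (X - C 1) ^ (2 * n + 1) ∣ F by
    have := eval_dvd (x := u) h
    simpa [hF, eval_finsetSum] using this
  rw [X_sub_C_pow_dvd_iff, X_pow_dvd_iff]
  intro d hd
  have hcoeff : (F.comp (X + C 1)).coeff d =
      ∑ i ∈ range (n + 1), (padeCoeff l k n (n - i) : ℤ) * ((l * i + k).choose d : ℕ) -
        ∑ i ∈ range (n + 1), (padeCoeff l k n i : ℤ) * ((l * i).choose d : ℕ) := by
    simp [hF, sub_comp, finsetSum_coeff, coeff_X_add_one_pow,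
      -eq_intCast, -map_natCast]
  have hev : ∀ e : ℕ, (descPochhammer ℚ d).eval (e : ℚ) = d.factorial * (e.choose d : ℚ) := by
    intro e
    rw [descPochhammer_eval_eq_descFactorial, Nat.descFactorial_eq_factorial_mul_choose]
    push_cast; ring
  have hz := sum_padeCoeff_mul_eval hl hk0 hk (n := n) (g := descPochhammer ℚ d)
    (by rw [descPochhammer_natDegree]; omega)
  simp only [hev] at hz
  rw [hcoeff]
  have hd0 : (d.factorial : ℚ) ≠ 0 := by exact_mod_cast Nat.factorial_ne_zero d
  have hz' : (d.factorial : ℚ) * (∑ i ∈ range (n + 1), (padeCoeff l k n (n - i) : ℚ) *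
      ((l * i + k).choose d : ℚ) -
      ∑ i ∈ range (n + 1), (padeCoeff l k n i : ℚ) * ((l * i).choose d : ℚ)) = 0 := by
    rw [← hz, mul_sub, mul_sum, mul_sum]
    congr 1 <;> exact sum_congr rfl fun i _ => by ring
  have := (mul_eq_zero.1 hz').resolve_left hd0
  exact_mod_cast this

/-! ### Roots of unity modulo prime powers -/

lemma pow_modEq_one_of_dvd_geom_sum {x l d : ℕ} (hx : 1 ≤ x) (h : d ∣ ∑ i ∈ Finset.range l, x ^ i) :
    x ^ l ≡ 1 [MOD d] := by
  have h1 : (x ^ l : ℕ) = (∑ i ∈ Finset.range l, x ^ i) * (x - 1) + 1 := by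
    rw [geom_sum_mul_of_one_le hx]
    exact (Nat.sub_add_cancel (Nat.one_le_pow _ _ hx)).symm
  rw [h1]
  simpa using ((Nat.modEq_zero_iff_dvd.2 (h.mul_right (x - 1))).add_right 1)

lemma prime_ne_of_dvd_geom_sum {x l P : ℕ} (hl : l.Prime) (hx : 1 ≤ x) (hxl : ¬ x ≡ 1 [MOD l])
    (h : P ∣ ∑ i ∈ Finset.range l, x ^ i) : P ≠ l := by
  rintro rfl
  have := Fact.mk hl
  have h1 := pow_modEq_one_of_dvd_geom_sum hx h
  rw [← ZMod.natCast_eq_natCast_iff] at h1 hxl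
  push_cast at h1 hxl
  rw [ZMod.pow_card] at h1
  exact hxl h1

lemma not_modEq_one_of_dvd_geom_sum {x l P : ℕ} (hl : l.Prime) (hP : P.Prime) (hx : 1 ≤ x)
    (hxl : ¬ x ≡ 1 [MOD l]) (h : P ∣ ∑ i ∈ Finset.range l, x ^ i) : ¬ x ≡ 1 [MOD P] := by
  intro h1
  have h2 : ∑ i ∈ Finset.range l, x ^ i ≡ ∑ i ∈ Finset.range l, 1 ^ i [MOD P] :=
    Nat.ModEq.sum fun i _ => h1.pow i
  have h3 : P ∣ l := by simpa using (h2.dvd_iff dvd_rfl).1 h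
  exact prime_ne_of_dvd_geom_sum hl hx hxl h ((Nat.prime_dvd_prime_iff_eq hP hl).1 h3)

/-- The `l`-th roots of unity are distinct modulo a prime `P ≠ l`. -/
lemma modEq_prime_pow_of_modEq {l P m z w : ℕ} (hl : l.Prime) (hP : P.Prime) (hPl : P ≠ l)
    (hm : 1 ≤ m) (hz : z ^ l ≡ 1 [MOD P ^ m]) (hw : w ^ l ≡ 1 [MOD P ^ m])
    (hzw : z ≡ w [MOD P]) : z ≡ w [MOD P ^ m] := by
  have hPZ : Prime (P : ℤ) := Nat.prime_iff_prime_int.1 hP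
  have hPm : P ∣ P ^ m := dvd_pow_self P (by omega)
  have hz0 : ¬ (P : ℤ) ∣ (w : ℤ) := by
    intro h
    have h1 : P ∣ w ^ l := dvd_pow (Int.natCast_dvd_natCast.1 h) hl.ne_zero
    exact hP.one_lt.ne' (Nat.dvd_one.1 (((hw.of_dvd hPm).dvd_iff dvd_rfl).1 h1))
  have hl0 : ¬ (P : ℤ) ∣ (l : ℤ) := fun h =>
    hPl ((Nat.prime_dvd_prime_iff_eq hP hl).1 (Int.natCast_dvd_natCast.1 h))
  have h1 : (P : ℤ) ∣ (w : ℤ) - z := Nat.modEq_iff_dvd.1 hzw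
  have h2 := not_dvd_geom_sum₂ hPZ h1 hz0 hl0
  have h3 : ((P ^ m : ℕ) : ℤ) ∣ (w : ℤ) ^ l - z ^ l := by
    have := Nat.modEq_iff_dvd.1 (hz.trans hw.symm)
    simpa using this
  rw [← (Commute.all (w : ℤ) (z : ℤ)).geom_sum₂_mul] at h3
  refine Nat.modEq_iff_dvd.2 ?_
  push_cast at h3 ⊢
  exact (hPZ.pow_dvd_of_dvd_mul_left m h2 h3)

lemma pow_mul_pow_eq_iff {x y a b c d : ℕ} (hx : x.Prime) (hy : y.Prime) (hxy : x ≠ y) :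
    x ^ a * y ^ b = x ^ c * y ^ d ↔ a = c ∧ b = d := by
  refine ⟨fun h => ?_, fun ⟨h1, h2⟩ => by rw [h1, h2]⟩
  have h0 : ∀ (z : ℕ) (e : ℕ), z.Prime → z ^ e ≠ 0 := fun z e hz => pow_ne_zero _ hz.ne_zero
  have hf := congrArg Nat.factorization h
  rw [Nat.factorization_mul (h0 x a hx) (h0 y b hy), Nat.factorization_mul (h0 x c hx) (h0 y d hy),
    hx.factorization_pow, hx.factorization_pow, hy.factorization_pow, hy.factorization_pow] at hf
  have h1 := DFunLike.congr_fun hf x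
  have h2 := DFunLike.congr_fun hf y
  simp only [Finsupp.add_apply, Finsupp.single_eq_same, Finsupp.single_apply, if_neg hxy,
    if_neg hxy.symm] at h1 h2
  omega

/-- There are at most `l` roots of unity of order `l` modulo `P ^ m`, so more than `l` monomials in
two such roots that are distinct primes cannot all lie below `P ^ m`. -/
lemma exists_le_pow_mul_pow {l P m x y : ℕ} (hl : l.Prime) (hP : P.Prime) (hPl : P ≠ l)
    (hm : 1 ≤ m) (hx : x.Prime) (hy : y.Prime) (hxy : x ≠ y)
    (hxl : x ^ l ≡ 1 [MOD P ^ m]) (hyl : y ^ l ≡ 1 [MOD P ^ m])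
    (S : Finset (ℕ × ℕ)) (hS : l < S.card) : ∃ s ∈ S, P ^ m ≤ x ^ s.1 * y ^ s.2 := by
  classical
  have := Fact.mk hP
  by_contra! hlt
  have hroot : ∀ s : ℕ × ℕ, (x ^ s.1 * y ^ s.2) ^ l ≡ 1 [MOD P ^ m] := by
    intro s
    have h1 := (hxl.pow s.1).mul (hyl.pow s.2)
    rw [one_pow, one_pow, one_mul, ← pow_mul, ← pow_mul, mul_comm l, mul_comm l, pow_mul,
      pow_mul, ← mul_pow] at h1
    exact h1
  have hmaps : ∀ s ∈ S, ((x ^ s.1 * y ^ s.2 : ℕ) : ZMod P) ∈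
      (Polynomial.nthRoots l (1 : ZMod P)).toFinset := by
    intro s _
    rw [Multiset.mem_toFinset, Polynomial.mem_nthRoots hl.pos]
    have := (hroot s).of_dvd (dvd_pow_self P (by omega : m ≠ 0))
    rw [← ZMod.natCast_eq_natCast_iff] at this
    exact_mod_cast this
  have hcard : (Polynomial.nthRoots l (1 : ZMod P)).toFinset.card < S.card :=
    ((Multiset.toFinset_card_le _).trans (Polynomial.card_nthRoots l 1)).trans_lt hS
  obtain ⟨s, hs, t, ht, hst, heq⟩ := Finset.exists_ne_map_eq_of_card_lt_of_maps_to hcard hmaps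
  have h1 := modEq_prime_pow_of_modEq hl hP hPl hm (hroot s) (hroot t)
    ((ZMod.natCast_eq_natCast_iff _ _ _).1 heq)
  have h2 := Nat.ModEq.eq_of_lt_of_lt h1 (hlt s hs) (hlt t ht)
  exact hst (Prod.ext_iff.2 ((pow_mul_pow_eq_iff hx hy hxy).1 h2))

/-- A root `y ≢ 1` generates the group of `l`-th roots of unity modulo `P ^ m`. -/
lemma exists_mul_pow_modEq_one {l P m x y : ℕ} (hl : l.Prime) (hP : P.Prime) (hPl : P ≠ l)
    (hm : 1 ≤ m) (hxl : x ^ l ≡ 1 [MOD P ^ m]) (hyl : y ^ l ≡ 1 [MOD P ^ m])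
    (hy : ¬ y ≡ 1 [MOD P]) : ∃ h, x * y ^ h ≡ 1 [MOD P ^ m] := by
  have := Fact.mk hP
  have := Fact.mk hl
  have hPm : P ∣ P ^ m := dvd_pow_self P (by omega)
  have hx' : (x : ZMod P) ^ l = 1 := by
    have := (ZMod.natCast_eq_natCast_iff _ _ _).2 (hxl.of_dvd hPm)
    exact_mod_cast this
  have hy' : (y : ZMod P) ^ l = 1 := by
    have := (ZMod.natCast_eq_natCast_iff _ _ _).2 (hyl.of_dvd hPm)
    exact_mod_cast this
  have hy1 : (y : ZMod P) ≠ 1 := fun h =>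
    hy ((ZMod.natCast_eq_natCast_iff _ _ _).1 (by exact_mod_cast h))
  have hprim : IsPrimitiveRoot (y : ZMod P) l := by
    rw [← orderOf_eq_prime hy' hy1]; exact IsPrimitiveRoot.orderOf _
  obtain ⟨h, -, hh⟩ := hprim.eq_pow_of_pow_eq_one (ξ := (x : ZMod P) ^ (l - 1))
    (by rw [← pow_mul, mul_comm, pow_mul, hx', one_pow])
  refine ⟨h, modEq_prime_pow_of_modEq hl hP hPl hm ?_ (by rw [one_pow]) ?_⟩
  · have h1 := hxl.mul (hyl.pow h)
    rwa [one_pow, one_mul, ← pow_mul, mul_comm l h, pow_mul, ← mul_pow] at h1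
  · refine (ZMod.natCast_eq_natCast_iff _ _ _).1 ?_
    push_cast
    rw [hh, ← pow_succ', Nat.sub_add_cancel hl.one_le, hx']

/-! ### Gaps between solutions -/

lemma pow_lt_geom_sum {l : ℕ} (x : ℕ) (hl : 2 ≤ l) :
    x ^ (l - 1) < ∑ i ∈ Finset.range l, x ^ i := by
  obtain ⟨d, rfl⟩ := Nat.exists_eq_add_of_le hl
  rw [show 2 + d = d + 1 + 1 by ring, Finset.sum_range_succ, Finset.sum_range_succ',
    Nat.add_sub_cancel]
  simp

lemma geom_sum_strictMono {x y l : ℕ} (hxy : x < y) (hl : 2 ≤ l) :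
    ∑ i ∈ Finset.range l, x ^ i < ∑ i ∈ Finset.range l, y ^ i :=
  Finset.sum_lt_sum (fun i _ => Nat.pow_le_pow_left hxy.le i)
    ⟨1, Finset.mem_range.2 (by omega), by simpa using hxy⟩

lemma exponent_lt {x y l p q m M : ℕ} (hp : p.Prime) (hl : 2 ≤ l) (hxy : x < y)
    (hx : ∑ i ∈ Finset.range l, x ^ i = p ^ m * q)
    (hy : ∑ i ∈ Finset.range l, y ^ i = p ^ M * q) : m < M := by
  have h := geom_sum_strictMono hxy hl
  rw [hx, hy] at h
  exact (Nat.pow_lt_pow_iff_right hp.one_lt).1 (lt_of_mul_lt_mul_right h (Nat.zero_le q))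

/-- If `q` is small, then `p ^ m` exceeds the `l + 1` monomials `x ^ a` (`a < l - c`) and
`x ^ a * y` (`a ≤ c`) unless `y` is large. -/
lemma pow_le_of_lt {x y l p q m M c : ℕ} (hl : l.Prime) (hp : p.Prime) (hm : 1 ≤ m)
    (hxp : x.Prime) (hyp : y.Prime) (hxl : ¬ x ≡ 1 [MOD l]) (hxy : x < y)
    (hx : ∑ i ∈ Finset.range l, x ^ i = p ^ m * q)
    (hy : ∑ i ∈ Finset.range l, y ^ i = p ^ M * q)
    (hq : q ≤ x ^ c) (hc : 2 * c + 1 ≤ l) : x ^ (l - 2 * c - 1) ≤ y := by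
  by_contra! hlt
  have hmM := exponent_lt hp hl.two_le hxy hx hy
  have hdx : p ^ m ∣ ∑ i ∈ Finset.range l, x ^ i := hx ▸ dvd_mul_right _ _
  have hdy : p ^ m ∣ ∑ i ∈ Finset.range l, y ^ i :=
    hy ▸ (pow_dvd_pow p hmM.le).trans (dvd_mul_right _ _)
  have hpl : p ≠ l := prime_ne_of_dvd_geom_sum hl hxp.one_le hxl
    ((dvd_pow_self p (by omega)).trans hdx)
  have hbig : x ^ (l - 1 - c) < p ^ m := by
    have h1 := pow_lt_geom_sum x hl.two_le
    rw [hx] at h1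
    have h2 : x ^ (l - 1 - c) * x ^ c = x ^ (l - 1) := by rw [← pow_add]; congr 1; omega
    refine lt_of_mul_lt_mul_right (a := x ^ c) ?_ (Nat.zero_le _)
    rw [h2]
    exact h1.trans_le (Nat.mul_le_mul_left _ hq)
  obtain ⟨s, hs, hle⟩ := exists_le_pow_mul_pow hl hp hpl hm hxp hyp hxy.ne
    (pow_modEq_one_of_dvd_geom_sum hxp.one_le hdx) (pow_modEq_one_of_dvd_geom_sum hyp.one_le hdy)
    (Finset.range (l - c) ×ˢ {0} ∪ Finset.range (c + 1) ×ˢ {1}) (by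
      rw [Finset.card_union_of_disjoint]
      · simp only [Finset.card_product, Finset.card_range, Finset.card_singleton]; omega
      · rw [Finset.disjoint_left]
        rintro ⟨a, b⟩ h1 h2
        simp only [Finset.mem_product, Finset.mem_singleton] at h1 h2
        omega)
  obtain ⟨a, b⟩ := s
  change p ^ m ≤ x ^ a * y ^ b at hle
  simp only [Finset.mem_union, Finset.mem_product, Finset.mem_range, Finset.mem_singleton] at hs
  rcases hs with ⟨ha, rfl⟩ | ⟨ha, rfl⟩
  · rw [pow_zero, mul_one] at hle
    have := Nat.pow_le_pow_right hxp.pos (by omega : a ≤ l - 1 - c)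
    omega
  · rw [pow_one] at hle
    have h1 : x ^ a * y < x ^ c * x ^ (l - 2 * c - 1) :=
      Nat.mul_lt_mul_of_le_of_lt (Nat.pow_le_pow_right hxp.pos (by omega)) hlt (pow_pos hxp.pos _)
    rw [← pow_add, show c + (l - 2 * c - 1) = l - 1 - c by omega] at h1
    omega

/-- Two solutions bound `q`, by the monomials of degree at most `t` modulo `q`. -/
lemma prime_le_pow {x y l q t : ℕ} (hl : l.Prime) (hq : q.Prime) (hxp : x.Prime) (hyp : y.Prime)
    (hxl : ¬ x ≡ 1 [MOD l]) (hxy : x < y) (hx : q ∣ ∑ i ∈ Finset.range l, x ^ i)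
    (hy : q ∣ ∑ i ∈ Finset.range l, y ^ i) (ht : 2 * l < (t + 1) * (t + 2)) : q ≤ y ^ t := by
  set S : Finset (ℕ × ℕ) := ((Finset.range (t + 1)).sigma fun a => Finset.range (t - a + 1)).image
    fun s => (s.1, s.2) with hS
  have hcard : l < S.card := by
    have h1 : S.card = ∑ a ∈ Finset.range (t + 1), (a + 1) := by
      have hinj : Function.Injective fun s : (_ : ℕ) × ℕ => (s.1, s.2) := by
        rintro ⟨a, b⟩ ⟨a', b'⟩ h
        simpa using h
      rw [hS, Finset.card_image_of_injective _ hinj, Finset.card_sigma, ← Finset.sum_range_reflect]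
      refine Finset.sum_congr rfl fun a ha => ?_
      have := Finset.mem_range.1 ha
      rw [Finset.card_range]; omega
    have h2 : S.card = ∑ a ∈ Finset.range (t + 2), a := by
      rw [h1, Finset.sum_range_succ' _ (t + 1)]; rfl
    have h3 := Finset.sum_range_id_mul_two (t + 2)
    rw [← h2] at h3
    have h4 : (t + 2) * (t + 2 - 1) = (t + 1) * (t + 2) := by rw [mul_comm]; rfl
    omega
  obtain ⟨s, hs, hle⟩ := exists_le_pow_mul_pow (m := 1) hl hq
    (prime_ne_of_dvd_geom_sum hl hxp.one_le hxl hx) le_rfl hxp hyp hxy.ne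
    (pow_modEq_one_of_dvd_geom_sum hxp.one_le (by rwa [pow_one]))
    (pow_modEq_one_of_dvd_geom_sum hyp.one_le (by rwa [pow_one])) S hcard
  have hst : s.1 + s.2 ≤ t := by
    simp only [hS, Finset.mem_image, Finset.mem_sigma, Finset.mem_range] at hs
    obtain ⟨s', ⟨h1, h2⟩, rfl⟩ := hs
    change s'.1 + s'.2 ≤ t
    omega
  calc q ≤ x ^ s.1 * y ^ s.2 := by simpa using hle
    _ ≤ y ^ s.1 * y ^ s.2 := Nat.mul_le_mul_right _ (Nat.pow_le_pow_left hxy.le _)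
    _ = y ^ (s.1 + s.2) := (pow_add _ _ _).symm
    _ ≤ y ^ t := Nat.pow_le_pow_right hyp.pos hst

/-! ### At most one large solution -/

lemma exists_mul_add_one_modEq_zero {l h : ℕ} (hl : l.Prime) (hh : ¬ l ∣ h) :
    ∃ k, 0 < k ∧ k < l ∧ l ∣ h * k + 1 := by
  have := Fact.mk hl
  have hh0 : (h : ZMod l) ≠ 0 := fun h0 => hh ((ZMod.natCast_eq_zero_iff _ _).1 h0)
  refine ⟨(-(h : ZMod l)⁻¹).val, ?_, ZMod.val_lt _, ?_⟩
  · rw [Nat.pos_iff_ne_zero, Ne, ZMod.val_eq_zero, neg_eq_zero]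
    exact inv_ne_zero hh0
  · rw [← ZMod.natCast_eq_zero_iff]
    push_cast
    rw [ZMod.natCast_val, ZMod.cast_id, mul_neg, mul_inv_cancel₀ hh0, neg_add_cancel]

open Finset in
/-- If `x` approximates a root of unity modulo `p ^ M` whose `k`-th power is `y`, the Padé
approximants at `x ^ l` yield an integer divisible by a high power of `p`. -/
lemma pow_dvd_pade_form {l k p m M n x y h : ℕ} (hl : l.Prime) (hk0 : 0 < k) (hk : k < l)
    (hxy : x * y ^ h ≡ 1 [MOD p ^ m]) (hyl : y ^ l ≡ 1 [MOD p ^ M]) (hhk : l ∣ h * k + 1) :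
    ((p ^ min (m * (2 * n + 1)) M : ℕ) : ℤ) ∣
      (x ^ k * ∑ i ∈ range (n + 1), padeCoeff l k n (n - i) * (x ^ l) ^ i : ℕ) -
      (y * ∑ i ∈ range (n + 1), padeCoeff l k n i * (x ^ l) ^ i : ℕ) := by
  -- `u` is the ratio of `x` and the root of unity `y ^ (-h)` that it approximates.
  set u : ℕ := x * y ^ h with hu
  have h1 : ((p ^ (m * (2 * n + 1)) : ℕ) : ℤ) ∣
      ∑ i ∈ range (n + 1), (padeCoeff l k n (n - i) : ℤ) * (u : ℤ) ^ (l * i + k) -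
        ∑ i ∈ range (n + 1), (padeCoeff l k n i : ℤ) * (u : ℤ) ^ (l * i) := by
    refine dvd_trans ?_ (sub_one_pow_dvd_pade hl hk0 hk n (u : ℤ))
    rw [pow_mul]
    push_cast
    refine pow_dvd_pow_of_dvd ?_ _
    have := Nat.modEq_iff_dvd.1 hxy.symm
    simpa using this
  have hyl' : ∀ e, l ∣ e → y ^ e ≡ 1 [MOD p ^ M] := by
    rintro _ ⟨e, rfl⟩
    rw [pow_mul]
    simpa using hyl.pow e
  have h2 : ∀ i, y * u ^ (l * i + k) ≡ x ^ k * (x ^ l) ^ i [MOD p ^ M] := by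
    intro i
    have e1 : y * u ^ (l * i + k) = x ^ k * (x ^ l) ^ i * y ^ (l * (h * i) + (h * k + 1)) := by
      rw [hu, mul_pow, ← pow_mul, ← pow_mul, ← pow_add, mul_left_comm, ← pow_succ',
        show h * (l * i + k) + 1 = l * (h * i) + (h * k + 1) by ring, add_comm k]
    rw [e1]
    simpa using (hyl' _ (dvd_add (dvd_mul_right l _) hhk)).mul_left (x ^ k * (x ^ l) ^ i)
  have h3 : ∀ i, u ^ (l * i) ≡ (x ^ l) ^ i [MOD p ^ M] := by
    intro i
    have e1 : u ^ (l * i) = (x ^ l) ^ i * y ^ (l * (h * i)) := by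
      rw [hu, mul_pow, ← pow_mul, ← pow_mul, show h * (l * i) = l * (h * i) by ring]
    rw [e1]
    simpa using (hyl' _ (dvd_mul_right l (h * i))).mul_left ((x ^ l) ^ i)
  have h4 : y * ∑ i ∈ range (n + 1), padeCoeff l k n (n - i) * u ^ (l * i + k) ≡
      x ^ k * ∑ i ∈ range (n + 1), padeCoeff l k n (n - i) * (x ^ l) ^ i [MOD p ^ M] := by
    rw [mul_sum, mul_sum]
    refine Nat.ModEq.sum fun i _ => ?_
    rw [mul_left_comm, mul_left_comm (x ^ k)]
    exact (h2 i).mul_left _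
  have h5 : y * ∑ i ∈ range (n + 1), padeCoeff l k n i * u ^ (l * i) ≡
      y * ∑ i ∈ range (n + 1), padeCoeff l k n i * (x ^ l) ^ i [MOD p ^ M] :=
    (Nat.ModEq.sum fun i _ => (h3 i).mul_left _).mul_left y
  have d4 := (Int.natCast_dvd_natCast.2 (pow_dvd_pow p (min_le_right (m * (2 * n + 1)) M))).trans
    (Nat.modEq_iff_dvd.1 h4)
  have d5 := (Int.natCast_dvd_natCast.2 (pow_dvd_pow p (min_le_right (m * (2 * n + 1)) M))).trans
    (Nat.modEq_iff_dvd.1 h5)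
  have d1 := ((Int.natCast_dvd_natCast.2
    (pow_dvd_pow p (min_le_left (m * (2 * n + 1)) M))).trans h1).mul_left (y : ℤ)
  obtain ⟨c, hc⟩ := (d1.add d4).sub d5
  refine ⟨c, ?_⟩
  push_cast at hc ⊢
  linear_combination hc

/-- The Padé form does not vanish and is at most `2 * y * (4 * l ^ 2 * x ^ l) ^ n`, as soon as `y`
is large compared to `x ^ k`; the two terms have opposite signs, so only the larger one counts. -/
lemma pow_le_of_pade_form {l k p m M n x y h : ℕ} (hl : l.Prime) (hk0 : 0 < k) (hk : k < l)
    (hx : 1 ≤ x) (hxy : x * y ^ h ≡ 1 [MOD p ^ m]) (hyl : y ^ l ≡ 1 [MOD p ^ M])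
    (hhk : l ∣ h * k + 1) (hbig : 2 * x ^ k * 4 ^ n < y) :
    p ^ min (m * (2 * n + 1)) M ≤ y * (2 * (4 * l ^ 2 * x ^ l) ^ n) := by
  have hdvd := pow_dvd_pade_form (n := n) hl hk0 hk hxy hyl hhk
  set A := ∑ i ∈ Finset.range (n + 1), padeCoeff l k n (n - i) * (x ^ l) ^ i with hA
  set B := ∑ i ∈ Finset.range (n + 1), padeCoeff l k n i * (x ^ l) ^ i with hB
  have hT : 1 ≤ x ^ l := Nat.one_le_pow _ _ hx
  have hAle : A ≤ 2 * (4 * l ^ 2 * x ^ l) ^ n := sum_mul_pow_le hT _ fun i hi => by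
    have := padeCoeff_le hl hk.le (Nat.sub_le n i)
    rwa [Nat.choose_symm hi] at this
  have hBle : B ≤ 2 * (4 * l ^ 2 * x ^ l) ^ n := sum_mul_pow_le hT _ fun i hi =>
    padeCoeff_le hl hk.le hi
  have hBge : l ^ (2 * n) * (x ^ l) ^ n ≤ B :=
    (Nat.mul_le_mul_right _ (le_padeCoeff_self hl n)).trans
      (Finset.single_le_sum (f := fun i => padeCoeff l k n i * (x ^ l) ^ i)
        (fun _ _ => Nat.zero_le _) (Finset.mem_range.2 (Nat.lt_succ_self n)))
  have hlt : x ^ k * A < y * B := by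
    have hpos : 0 < l ^ (2 * n) * (x ^ l) ^ n := by
      have := hl.pos
      positivity
    calc x ^ k * A ≤ x ^ k * (2 * (4 * l ^ 2 * x ^ l) ^ n) := Nat.mul_le_mul_left _ hAle
      _ = (2 * x ^ k * 4 ^ n) * (l ^ (2 * n) * (x ^ l) ^ n) := by
          rw [mul_pow, mul_pow, ← pow_mul l]; ring
      _ < y * (l ^ (2 * n) * (x ^ l) ^ n) := Nat.mul_lt_mul_of_pos_right hbig hpos
      _ ≤ y * B := Nat.mul_le_mul_left _ hBge
  rw [← neg_sub, dvd_neg, ← Nat.cast_sub hlt.le, Int.natCast_dvd_natCast] at hdvd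
  calc p ^ min (m * (2 * n + 1)) M ≤ y * B - x ^ k * A := Nat.le_of_dvd (by omega) hdvd
    _ ≤ y * B := Nat.sub_le _ _
    _ ≤ _ := Nat.mul_le_mul_left _ hBle

/-- The Thue–Siegel phenomenon: when `q` is small compared to `x`, there is no solution far above
`x`. The order `n` of the approximation is chosen so that `y` is about `x ^ ((l - 7) * n)`; then
both `p ^ (m * (2 * n + 1))` and `p ^ M` exceed the bound of `pow_le_of_pade_form`. -/
lemma lt_pow_of_geom_sum_eq {l p q m M x y : ℕ} (hl : l.Prime) (hl19 : 19 ≤ l) (hp : p.Prime)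
    (hm : 1 ≤ m) (hx : 1 ≤ x) (hy : 1 ≤ y) (hxl : ¬ x ≡ 1 [MOD l]) (hyl : ¬ y ≡ 1 [MOD l])
    (hgx : ∑ i ∈ Finset.range l, x ^ i = p ^ m * q)
    (hgy : ∑ i ∈ Finset.range l, y ^ i = p ^ M * q) (hmM : m ≤ M)
    (hlq : l < q) (hqx : q ≤ x) : y < x ^ (4 * l) := by
  by_contra! hxy
  have hlx : l < x := hlq.trans_le hqx
  have hx1 : 1 < x := by omega
  have hdx : p ^ m ∣ ∑ i ∈ Finset.range l, x ^ i := hgx ▸ dvd_mul_right _ _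
  have hdy : p ^ M ∣ ∑ i ∈ Finset.range l, y ^ i := hgy ▸ dvd_mul_right _ _
  have hdy' := (pow_dvd_pow p hmM).trans hdy
  have hpm : p ∣ p ^ m := dvd_pow_self p (by omega)
  have hpl : p ≠ l := prime_ne_of_dvd_geom_sum hl hx hxl (hpm.trans hdx)
  have hx1p := not_modEq_one_of_dvd_geom_sum hl hp hx hxl (hpm.trans hdx)
  have hy1p := not_modEq_one_of_dvd_geom_sum hl hp hy hyl (hpm.trans hdy')
  have hyM := pow_modEq_one_of_dvd_geom_sum hy hdy
  obtain ⟨h, hh⟩ := exists_mul_pow_modEq_one hl hp hpl hm (pow_modEq_one_of_dvd_geom_sum hx hdx)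
    (pow_modEq_one_of_dvd_geom_sum hy hdy') hy1p
  have hlh : ¬ l ∣ h := by
    rintro ⟨e, rfl⟩
    have h1 : y ^ (l * e) ≡ 1 [MOD p] := by
      rw [pow_mul]
      simpa using (hyM.of_dvd (hpm.trans (pow_dvd_pow p hmM))).pow e
    exact hx1p (by simpa using (h1.mul_left x).symm.trans (hh.of_dvd hpm))
  obtain ⟨k, hk0, hk, hhk⟩ := exists_mul_add_one_modEq_zero hl hlh
  -- The least `n` for which `y` is at most `x ^ ((l - 7) * n)`.
  have hex : ∃ n, y ≤ x ^ ((l - 7) * n) :=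
    ⟨y, (Nat.lt_pow_self hx1).le.trans
      (Nat.pow_le_pow_right hx (Nat.le_mul_of_pos_left y (by omega)))⟩
  obtain ⟨n, hn, hmin⟩ : ∃ n, y ≤ x ^ ((l - 7) * n) ∧ x ^ ((l - 7) * (n - 1)) < y := by
    classical
    refine ⟨Nat.find hex, Nat.find_spec hex, ?_⟩
    have hpos : Nat.find hex ≠ 0 := by
      intro h0
      have h1 := Nat.find_spec hex
      rw [h0, mul_zero, pow_zero] at h1
      have h2 : 1 < x ^ (4 * l) := Nat.one_lt_pow (by omega) hx1
      omega
    exact not_le.1 (Nat.find_min hex (by omega))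
  obtain ⟨a, rfl⟩ := Nat.exists_eq_add_of_le hl19
  have ha7 : 19 + a - 7 = 12 + a := by omega
  rw [ha7] at hn hmin
  have hn5 : 5 ≤ n := by
    have h1 := (Nat.pow_le_pow_iff_right hx1).1 (hxy.trans hn)
    by_contra! h2
    have h3 : (12 + a) * n ≤ (12 + a) * 4 := Nat.mul_le_mul_left _ (by omega)
    omega
  obtain ⟨b, rfl⟩ := Nat.exists_eq_add_of_le hn5
  rw [show 5 + b - 1 = 4 + b by omega] at hmin
  have hC : 4 * (19 + a) ^ 2 * x ^ (19 + a) ≤ x ^ (22 + a) := by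
    have h1 : 4 * (19 + a) ^ 2 ≤ x ^ 3 := by
      have : (19 + a) ^ 2 ≤ x ^ 2 := Nat.pow_le_pow_left hlx.le 2
      rw [pow_succ' x 2]
      exact Nat.mul_le_mul (by omega) this
    calc _ ≤ x ^ 3 * x ^ (19 + a) := Nat.mul_le_mul_right _ h1
      _ = _ := by rw [← pow_add]; congr 1; omega
  have hCn : 2 * (4 * (19 + a) ^ 2 * x ^ (19 + a)) ^ (5 + b) ≤ x ^ ((22 + a) * (5 + b) + 1) := by
    rw [pow_succ' x, pow_mul]
    exact Nat.mul_le_mul (by omega) (Nat.pow_le_pow_left hC _)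
  have hbig : 2 * x ^ k * 4 ^ (5 + b) < y := by
    refine lt_of_le_of_lt ?_ hmin
    calc 2 * x ^ k * 4 ^ (5 + b) ≤ x * x ^ (18 + a) * x ^ (5 + b) := by
          gcongr <;> omega
      _ = x ^ (24 + a + b) := by rw [← pow_succ', ← pow_add]; congr 1; omega
      _ ≤ x ^ ((12 + a) * (4 + b)) := Nat.pow_le_pow_right hx (by nlinarith)
  have hmain := pow_le_of_pade_form hl hk0 hk hx hh hyM hhk hbig
  have hpmx : x ^ (17 + a) < p ^ m := by
    have h1 := pow_lt_geom_sum x hl.two_le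
    rw [hgx, show 19 + a - 1 = 17 + a + 1 by omega, pow_succ] at h1
    exact lt_of_mul_lt_mul_right (h1.trans_le (Nat.mul_le_mul_left _ hqx)) (Nat.zero_le _)
  have h1 : y * (2 * (4 * (19 + a) ^ 2 * x ^ (19 + a)) ^ (5 + b)) <
      p ^ (m * (2 * (5 + b) + 1)) := by
    calc _ ≤ x ^ ((12 + a) * (5 + b)) * x ^ ((22 + a) * (5 + b) + 1) := Nat.mul_le_mul hn hCn
      _ = x ^ ((17 + a) * (2 * (5 + b)) + 1) := by rw [← pow_add]; congr 1; ring
      _ ≤ x ^ ((17 + a) * (2 * (5 + b) + 1)) := Nat.pow_le_pow_right hx (by nlinarith)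
      _ = (x ^ (17 + a)) ^ (2 * (5 + b) + 1) := pow_mul _ _ _
      _ < (p ^ m) ^ (2 * (5 + b) + 1) := Nat.pow_lt_pow_left hpmx (by omega)
      _ = _ := (pow_mul _ _ _).symm
  have h2 : y * (2 * (4 * (19 + a) ^ 2 * x ^ (19 + a)) ^ (5 + b)) < p ^ M := by
    have e1 := pow_lt_geom_sum y hl.two_le
    rw [hgy, show 19 + a - 1 = 17 + a + 1 by omega, pow_succ'] at e1
    have e2 : x ^ ((22 + a) * (5 + b) + 1) * x ≤ y ^ (17 + a) := by
      calc x ^ ((22 + a) * (5 + b) + 1) * x = x ^ ((22 + a) * (5 + b) + 2) := (pow_succ _ _).symm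
        _ ≤ x ^ ((12 + a) * (4 + b) * (17 + a)) := Nat.pow_le_pow_right hx (by
            calc (22 + a) * (5 + b) + 2 ≤ (12 + a) * (4 + b) * 17 := by nlinarith
              _ ≤ _ := Nat.mul_le_mul_left _ (by omega))
        _ = (x ^ ((12 + a) * (4 + b))) ^ (17 + a) := pow_mul _ _ _
        _ ≤ y ^ (17 + a) := Nat.pow_le_pow_left hmin.le _
    refine lt_of_mul_lt_mul_right (a := x) ?_ (Nat.zero_le _)
    calc _ ≤ y * x ^ ((22 + a) * (5 + b) + 1) * x :=
          Nat.mul_le_mul_right _ (Nat.mul_le_mul_left _ hCn)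
      _ ≤ y * y ^ (17 + a) := by rw [mul_assoc]; exact Nat.mul_le_mul_left _ e2
      _ < p ^ M * q := e1
      _ ≤ p ^ M * x := Nat.mul_le_mul_left _ hqx
  rcases min_choice (m * (2 * (5 + b) + 1)) M with hc | hc <;> rw [hc] at hmain <;> omega

/-! ### Counting the solutions -/

lemma exists_degree {l : ℕ} (hl : 19 ≤ l) : ∃ t, 2 * l < (t + 1) * (t + 2) ∧ 3 * t + 1 ≤ l := by
  classical
  have hex : ∃ t, 2 * l < (t + 1) * (t + 2) := ⟨2 * l, by nlinarith⟩
  refine ⟨Nat.find hex, Nat.find_spec hex, ?_⟩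
  by_contra! h
  obtain ⟨t, ht⟩ : ∃ t, Nat.find hex = t + 1 := ⟨Nat.find hex - 1, by omega⟩
  have h1 := Nat.find_min hex (m := t) (by omega)
  rw [ht] at h
  nlinarith

/-- The equation has at most four prime solutions: five of them, `x₁ < ⋯ < x₅`, would give
`q ≤ x₂ ^ t ≤ x₃` and `x₅ ≥ x₄ ^ (l - 3) ≥ x₃ ^ ((l - 3) ^ 2) ≥ x₃ ^ (4 * l)`. -/
theorem card_prime_solutions_le_four {l p q : ℕ} (hl : l.Prime) (hl19 : 19 ≤ l) (hp : p.Prime)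
    (hq : q.Prime) (hql : q ≡ 1 [MOD l]) (A : Finset ℕ)
    (hA : ∀ x ∈ A, x.Prime ∧ ¬ x ≡ 1 [MOD l] ∧
      ∃ m, ∑ i ∈ Finset.range l, x ^ i = p ^ m * q) : A.card ≤ 4 := by
  by_contra! hcard
  obtain ⟨A', hA'A, hA'⟩ := Finset.exists_subset_card_eq (show 5 ≤ A.card from hcard)
  set x := A'.orderEmbOfFin hA' with hx
  have hmem : ∀ i, x i ∈ A := fun i => hA'A (A'.orderEmbOfFin_mem hA' i)
  have hxp : ∀ i, (x i).Prime := fun i => (hA _ (hmem i)).1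
  have hxl : ∀ i, ¬ x i ≡ 1 [MOD l] := fun i => (hA _ (hmem i)).2.1
  choose m hm using fun i => (hA _ (hmem i)).2.2
  have hlt : ∀ i j, i < j → x i < x j := fun i j h => x.strictMono h
  have hmlt : ∀ i j, i < j → m i < m j := fun i j h =>
    exponent_lt hp hl.two_le (hlt i j h) (hm i) (hm j)
  have hm01 := hmlt 0 1 (by decide)
  have hm12 := hmlt 1 2 (by decide)
  have hm23 := hmlt 2 3 (by decide)
  have hm34 := hmlt 3 4 (by decide)
  have hlq : l < q := by
    have h1 : l ∣ q - 1 := (Nat.modEq_iff_dvd' hq.one_le).1 hql.symm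
    have h2 := Nat.le_of_dvd (by have := hq.two_le; omega) h1
    omega
  obtain ⟨t, ht1, ht2⟩ := exists_degree hl19
  have hq1 : q ≤ x 1 ^ t := prime_le_pow hl hq (hxp 0) (hxp 1) (hxl 0) (hlt 0 1 (by decide))
    (hm 0 ▸ dvd_mul_left _ _) (hm 1 ▸ dvd_mul_left _ _) ht1
  have hq2 : q ≤ x 2 := by
    have h1 := pow_le_of_lt hl hp (by omega) (hxp 1) (hxp 2) (hxl 1) (hlt 1 2 (by decide))
      (hm 1) (hm 2) hq1 (by omega)
    exact hq1.trans ((Nat.pow_le_pow_right (hxp 1).pos (by omega)).trans h1)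
  have hq3 : q ≤ x 3 := hq2.trans (hlt 2 3 (by decide)).le
  have g3 := pow_le_of_lt (c := 1) hl hp (by omega) (hxp 2) (hxp 3) (hxl 2) (hlt 2 3 (by decide))
    (hm 2) (hm 3) (by rwa [pow_one]) (by omega)
  have g4 := pow_le_of_lt (c := 1) hl hp (by omega) (hxp 3) (hxp 4) (hxl 3) (hlt 3 4 (by decide))
    (hm 3) (hm 4) (by rwa [pow_one]) (by omega)
  have hfar := lt_pow_of_geom_sum_eq hl hl19 hp (by omega) (hxp 2).one_le (hxp 4).one_le (hxl 2)
    (hxl 4) (hm 2) (hm 4) (by omega) hlq hq2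
  refine absurd hfar (not_lt.2 ?_)
  calc x 2 ^ (4 * l) ≤ x 2 ^ ((l - 2 * 1 - 1) * (l - 2 * 1 - 1)) :=
        Nat.pow_le_pow_right (hxp 2).pos (by
          obtain ⟨a, rfl⟩ := Nat.exists_eq_add_of_le hl19
          rw [show 19 + a - 2 * 1 - 1 = 16 + a by omega]
          nlinarith)
    _ = (x 2 ^ (l - 2 * 1 - 1)) ^ (l - 2 * 1 - 1) := pow_mul _ _ _
    _ ≤ x 3 ^ (l - 2 * 1 - 1) := Nat.pow_le_pow_left g3 _
    _ ≤ x 4 := g4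

theorem lemma1 (l β : ℕ) (hlβ : l = 2 * β + 1) (hl : l.Prime) (hl19 : 19 ≤ l)
    (N p α r : ℕ) (q : Fin r → ℕ)
    (hp : p.Prime) (hq : ∀ i, (q i).Prime)
    (hq_inj : Function.Injective q) (hqp : ∀ i, q i ≠ p)
    (hN : N = p ^ α * ∏ i, q i ^ (2 * β))
    (hodd : Odd N) (hperf : N.Perfect)
    (j : Fin r) (hj : q j ≡ 1 [MOD l]) :
    (59 ≤ l →
      {i : Fin r | ¬ q i ≡ 1 [MOD l] ∧
        ∃ m : ℕ, (q i ^ l - 1) / (q i - 1) = p ^ m * q j}.ncard ≤ 5) ∧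
    (l ≤ 53 →
      {i : Fin r | ¬ q i ≡ 1 [MOD l] ∧
        ∃ m : ℕ, (q i ^ l - 1) / (q i - 1) = p ^ m * q j}.ncard ≤ 6) := by
  classical
  set S := {i : Fin r | ¬ q i ≡ 1 [MOD l] ∧
    ∃ m : ℕ, (q i ^ l - 1) / (q i - 1) = p ^ m * q j} with hS
  have h4 : S.ncard ≤ 4 := by
    rw [Set.ncard_eq_toFinset_card', ← Finset.card_image_of_injective _ hq_inj]
    refine card_prime_solutions_le_four hl hl19 hp (hq j) hj _ fun x hx => ?_
    obtain ⟨i, hi, rfl⟩ := Finset.mem_image.1 hx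
    obtain ⟨h1, m, h2⟩ := Set.mem_toFinset.1 hi
    exact ⟨hq i, h1, m, by rw [Nat.geomSum_eq (hq i).two_le, h2]⟩
  exact ⟨fun _ => by omega, fun _ => by omega⟩
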